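/- Let $S$ be a Polish space with its Borel $\sigma$-algebra, let $\mathcal{P}(S)$ be the set of Borel probability measures on $S$, $\mathcal{M}(S)$ the space of finite signed Borel measures on $S$, and $C_b(S)$ the space of bounded continuous functions $S\to\mathbb{R}$, equipped with the weak topology induced by $\mathcal{M}(S)$ (the coarsest topology making $f\mapsto\int_S f\,d\eta$ continuous for every $\eta\in\mathcal{M}(S)$). A set $\Gamma\subset C_b(S)$ is called admissible if (1) $\Gamma$ is convex and closed; (2) $g\in\Gamma$ implies $-g\in\Gamma$, and $\Gamma$ contains all constant functions; (3) for all $\mu\neq\nu$ in $\mathcal{P}(S)$ there is $g\in\Gamma$ with $\int_S g\,d\mu\neq\int_S g\,d\nu$. For $\Gamma\subset C_b(S)$, $\mu,\eta\in\mathcal{M}(S)$ and $\nu\in\mathcal{P}(S)$ put $$G_{\Gamma}(\mu\|\nu)=\sup_{g\in\Gamma}\Big\{\int_S g\,d\mu-\log\int_S e^{g}\,d\nu\Big\},\qquad W_{\Gamma}(\eta)=\sup_{g\in\Gamma}\int_S g\,d\eta ,$$ as extended real numbers, and write $W_\Gamma(\mu,\nu)=W_\Gamma(\mu-\nu)$ for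 $\mu,\nu\in\mathcal{P}(S)$. For $\delta>0$ let $\delta\Gamma=\{\delta f: f\in\Gamma\}$. Proposition. Let $\Gamma_0\subset C_b(S)$ be admissible and let $\mu,\nu\in\mathcal{P}(S)$. Then $$\lim_{\delta\downarrow 0}\frac{1}{\delta}\,G_{\delta\Gamma_0}(\mu\|\nu)=W_{\Gamma_0}(\mu,\nu)\quad\text{in }(-\infty,\infty],$$ including the case $W_{\Gamma_0}(\mu,\nu)=\infty$. -/

import Mathlib

open Filter Topology MeasureTheory BoundedContinuousFunction
open scoped Pointwise

noncomputable section

namespace GammaDiv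

variable {S : Type*} [TopologicalSpace S] [MeasurableSpace S]

/-- The weak topology on `C_b(S)` induced by the space of finite signed Borel measures: the
coarsest topology for which `f ↦ ∫ f dη` is continuous for every finite signed measure `η`. -/
abbrev weakTopology (S : Type*) [TopologicalSpace S] [MeasurableSpace S] :
    TopologicalSpace (S →ᵇ ℝ) :=
  ⨅ η : SignedMeasure S,
    TopologicalSpace.induced (fun f : S →ᵇ ℝ => ∫ᵛ x, f x ∂<•η) inferInstance

/-- Admissible sets of test functions `Γ ⊆ C_b(S)`. -/
structure IsAdmissible [OpensMeasurableSpace S] (Γ : Set (S →ᵇ ℝ)) : Prop where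
  convex : Convex ℝ Γ
  closed : IsClosed[weakTopology S] Γ
  symmetric : ∀ g ∈ Γ, -g ∈ Γ
  constants : ∀ c : ℝ, BoundedContinuousFunction.const S c ∈ Γ
  determining : ∀ μ ν : ProbabilityMeasure S, μ ≠ ν →
    ∃ g ∈ Γ, ∫ x, g x ∂(μ : Measure S) ≠ ∫ x, g x ∂(ν : Measure S)

/-- A probability measure, viewed as a finite signed measure. -/
def toSigned (μ : ProbabilityMeasure S) : SignedMeasure S :=
  (μ : Measure S).toSignedMeasure

/-- The `Γ`-divergence
`G_Γ(μ‖ν) = sup_{g ∈ Γ} (∫ g dμ - log ∫ e^g dν)`, with values in the extended reals. -/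
def G (Γ : Set (S →ᵇ ℝ)) (μ : SignedMeasure S) (ν : ProbabilityMeasure S) : EReal :=
  ⨆ g ∈ Γ, ((∫ᵛ x, g x ∂<•μ - Real.log (∫ x, Real.exp (g x) ∂(ν : Measure S)) : ℝ) : EReal)

/-- `W_Γ(η) = sup_{g ∈ Γ} ∫ g dη`, with values in the extended reals. -/
def W (Γ : Set (S →ᵇ ℝ)) (η : SignedMeasure S) : EReal :=
  ⨆ g ∈ Γ, ((∫ᵛ x, g x ∂<•η : ℝ) : EReal)

end GammaDiv

end

/-!
Writing the elements of `δ • Γ₀` as `δ • g`, one has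
`δ⁻¹ * G (δ • Γ₀) μ ν = sup_{g ∈ Γ₀} (∫ g dμ - δ⁻¹ * log ∫ e^{δ g} dν)`, where `log ∫ e^{δ g} dν` is
the cumulant generating function `cgf g ν δ`. Two facts about it suffice.

* Jensen's inequality gives `δ * ∫ g dν ≤ cgf g ν δ` (`mul_integral_le_cgf`), so that
  `δ⁻¹ * G (δ • Γ₀) μ ν ≤ W Γ₀ (μ - ν)` for every `δ > 0` (`G_smul_le`).
* The derivative of `cgf g ν` at `0` is `∫ g dν`, so that the term belonging to a fixed `g` tends
  to `∫ g dμ - ∫ g dν` as `δ ↓ 0` (`tendsto_integral_sub_cgf_div`).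

By the second fact, any `a < W Γ₀ (μ - ν)` is eventually exceeded by a single term of the
supremum, hence by the supremum. The argument treats finite and infinite `W Γ₀ (μ - ν)` alike.
-/

open ProbabilityTheory

namespace GammaDiv

lemma integral_toSigned {S : Type*} [MeasurableSpace S] (μ : ProbabilityMeasure S) (f : S → ℝ) :
    ∫ᵛ x, f x ∂<•(toSigned μ) = ∫ x, f x ∂(μ : Measure S) :=
  VectorMeasure.integral_toSignedMeasure

variable {S : Type*} [TopologicalSpace S] [MeasurableSpace S]

lemma G_smul (Γ : Set (S →ᵇ ℝ)) (μ ν : ProbabilityMeasure S) (δ : ℝ) :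
    G (δ • Γ) (toSigned μ) ν =
      ⨆ g ∈ Γ, ((δ * ∫ x, g x ∂(μ : Measure S) - cgf g (ν : Measure S) δ : ℝ) : EReal) := by
  rw [G, ← Set.image_smul, iSup_image]
  simp only [integral_toSigned, BoundedContinuousFunction.coe_smul, smul_eq_mul,
    integral_const_mul, cgf, mgf]

lemma le_G_smul {Γ : Set (S →ᵇ ℝ)} (μ ν : ProbabilityMeasure S) {g : S →ᵇ ℝ} (hg : g ∈ Γ)
    {δ : ℝ} (hδ : 0 < δ) :
    ((∫ x, g x ∂(μ : Measure S) - δ⁻¹ * cgf g (ν : Measure S) δ : ℝ) : EReal) ≤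
      ((1 / δ : ℝ) : EReal) * G (δ • Γ) (toSigned μ) ν := by
  have h : ∫ x, g x ∂(μ : Measure S) - δ⁻¹ * cgf g (ν : Measure S) δ =
      1 / δ * (δ * ∫ x, g x ∂(μ : Measure S) - cgf g (ν : Measure S) δ) := by
    field_simp
  rw [h, EReal.coe_mul, G_smul]
  exact mul_le_mul_of_nonneg_left
    (le_iSup₂ (f := fun (g : S →ᵇ ℝ) (_ : g ∈ Γ) =>
      ((δ * ∫ x, g x ∂(μ : Measure S) - cgf g (ν : Measure S) δ : ℝ) : EReal)) g hg)
    (by exact_mod_cast (one_div_pos.2 hδ).le)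

variable [OpensMeasurableSpace S]

lemma integral_toSigned_sub (μ ν : ProbabilityMeasure S) (g : S →ᵇ ℝ) :
    ∫ᵛ x, g x ∂<•(toSigned μ - toSigned ν) =
      ∫ x, g x ∂(μ : Measure S) - ∫ x, g x ∂(ν : Measure S) := by
  have h (ρ : ProbabilityMeasure S) : (toSigned ρ).Integrable g := by
    rw [VectorMeasure.Integrable, toSigned, Measure.variation_toSignedMeasure]
    exact g.integrable _
  rw [VectorMeasure.integral_sub_vectorMeasure (h μ) (h ν), integral_toSigned,
    integral_toSigned]

lemma integrable_exp_mul (ν : ProbabilityMeasure S) (g : S →ᵇ ℝ) (t : ℝ) :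
    Integrable (fun x => Real.exp (t * g x)) (ν : Measure S) :=
  integrable_exp_mul_of_mem_Icc (a := -‖g‖) (b := ‖g‖) g.continuous.measurable.aemeasurable
    (.of_forall fun x => abs_le.1 (g.norm_coe_le_norm x))

lemma integrableExpSet_eq_univ (ν : ProbabilityMeasure S) (g : S →ᵇ ℝ) :
    integrableExpSet g (ν : Measure S) = Set.univ :=
  Set.eq_univ_of_forall (integrable_exp_mul ν g)

/-- Jensen's inequality for the exponential. -/
lemma mul_integral_le_cgf (ν : ProbabilityMeasure S) (g : S →ᵇ ℝ) (t : ℝ) :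
    t * ∫ x, g x ∂(ν : Measure S) ≤ cgf g (ν : Measure S) t := by
  rw [← integral_const_mul, cgf, Real.le_log_iff_exp_le (mgf_pos (integrable_exp_mul ν g t))]
  exact convexOn_exp.map_integral_le Real.continuous_exp.continuousOn isClosed_univ
    (.of_forall fun _ => Set.mem_univ _) ((g.integrable _).const_mul t) (integrable_exp_mul ν g t)

lemma G_smul_le (Γ : Set (S →ᵇ ℝ)) (μ ν : ProbabilityMeasure S) {δ : ℝ} (hδ : 0 < δ) :
    ((1 / δ : ℝ) : EReal) * G (δ • Γ) (toSigned μ) ν ≤ W Γ (toSigned μ - toSigned ν) := by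
  have h : G (δ • Γ) (toSigned μ) ν ≤ (δ : EReal) * W Γ (toSigned μ - toSigned ν) := by
    rw [G_smul]
    refine iSup₂_le fun g hg => ?_
    calc ((δ * ∫ x, g x ∂(μ : Measure S) - cgf g (ν : Measure S) δ : ℝ) : EReal)
        ≤ ((δ * ∫ᵛ x, g x ∂<•(toSigned μ - toSigned ν) : ℝ) : EReal) := by
          rw [integral_toSigned_sub, mul_sub]
          exact_mod_cast sub_le_sub_left (mul_integral_le_cgf ν g δ) _
      _ ≤ (δ : EReal) * W Γ (toSigned μ - toSigned ν) := by
          rw [EReal.coe_mul]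
          exact mul_le_mul_of_nonneg_left
            (le_iSup₂ (f := fun (g : S →ᵇ ℝ) (_ : g ∈ Γ) =>
              ((∫ᵛ x, g x ∂<•(toSigned μ - toSigned ν) : ℝ) : EReal)) g hg)
            (by exact_mod_cast hδ.le)
  calc ((1 / δ : ℝ) : EReal) * G (δ • Γ) (toSigned μ) ν
      ≤ ((1 / δ : ℝ) : EReal) * ((δ : EReal) * W Γ (toSigned μ - toSigned ν)) :=
        mul_le_mul_of_nonneg_left h (by exact_mod_cast (one_div_pos.2 hδ).le)
    _ = W Γ (toSigned μ - toSigned ν) := by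
        rw [← mul_assoc, ← EReal.coe_mul, one_div_mul_cancel hδ.ne', EReal.coe_one, one_mul]

lemma tendsto_integral_sub_cgf_div (μ ν : ProbabilityMeasure S) (g : S →ᵇ ℝ) :
    Tendsto (fun δ : ℝ => ∫ x, g x ∂(μ : Measure S) - δ⁻¹ * cgf g (ν : Measure S) δ) (𝓝[>] 0)
      (𝓝 (∫ x, g x ∂(μ : Measure S) - ∫ x, g x ∂(ν : Measure S))) := by
  have h0 : (0 : ℝ) ∈ interior (integrableExpSet g (ν : Measure S)) := by
    simp [integrableExpSet_eq_univ]
  have hd : HasDerivAt (cgf g (ν : Measure S)) (∫ x, g x ∂(ν : Measure S)) 0 := by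
    have h := (analyticAt_cgf h0).differentiableAt.hasDerivAt
    rwa [deriv_cgf_zero h0, probReal_univ, div_one] at h
  simpa using (hd.tendsto_slope_zero_right).const_sub (∫ x, g x ∂(μ : Measure S))

end GammaDiv

theorem mainTheorem7 {S : Type*} [TopologicalSpace S] [PolishSpace S] [MeasurableSpace S]
    [BorelSpace S] (Γ₀ : Set (S →ᵇ ℝ)) (hΓ₀ : GammaDiv.IsAdmissible Γ₀)
    (μ ν : ProbabilityMeasure S) :
    Tendsto
      (fun δ : ℝ => ((1 / δ : ℝ) : EReal) * GammaDiv.G (δ • Γ₀) (GammaDiv.toSigned μ) ν)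
      (𝓝[>] 0)
      (𝓝 (GammaDiv.W Γ₀ (GammaDiv.toSigned μ - GammaDiv.toSigned ν))) := by
  refine tendsto_order.2 ⟨fun a ha => ?_, fun a ha => ?_⟩
  · simp only [GammaDiv.W, lt_iSup_iff, GammaDiv.integral_toSigned_sub] at ha
    obtain ⟨g, hg, hag⟩ := ha
    have hlim := (continuous_coe_real_ereal.tendsto _).comp
      (GammaDiv.tendsto_integral_sub_cgf_div μ ν g)
    filter_upwards [hlim.eventually (lt_mem_nhds hag), self_mem_nhdsWithin] with δ hδa hδ
    exact hδa.trans_le (GammaDiv.le_G_smul μ ν hg hδ)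
  · filter_upwards [self_mem_nhdsWithin] with δ hδ
    exact (GammaDiv.G_smul_le Γ₀ μ ν hδ).trans_lt ha
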